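/- Let $m,n,p\ge 0$ be integers and let $a\in\mathbb R^p$ satisfy $0\le a_1\le a_2\le\dots\le a_p$. For $B\in\mathbb R^{m\times p}$ and $C\in\mathbb R^{n\times p}$ with columns $B_i$, $C_i$ put $$\gamma_i(B,C)=\tfrac12\left(\|B_i\|^2+\|C_i\|^2\right),\qquad \gamma(B,C)=(\gamma_1(B,C),\dots,\gamma_p(B,C)),$$ with $\|\cdot\|$ the Euclidean norm. For $X\in\mathbb R^{m\times n}$ let $\sigma(X)=(\sigma_1(X),\dots,\sigma_p(X))$ be its $p$ largest singular values in non-increasing order, where $\sigma_i(X)=0$ for $i>\min(m,n)$. 1. For every $X\in\mathbb R^{m\times n}$ with $\operatorname{rank}X\le p$, $$\min_{BC^T=X} a^T\gamma(B,C)=a^T\sigma(X),$$ where $(B,C)$ ranges over $\mathbb R^{m\times p}\times\mathbb R^{n\times p}$; in particular the minimum exists. There are $B,C$ with $BC^T=X$ and $\gamma(B,C)=\sigma(X)$, so it is attained at $\gamma=\sigma$. 2. Let $\mathcal A$ be a linear map from $\mathbb R^{m\times n}$ to a real inner product space $W$ (for example $\mathbb R^q$), let $b\in W$, and put $$F(B,C)=a^T\gamma(B,C)+\|\mathcal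 A(BC^T)-b\|^2,\qquad G(X)=a^T\sigma(X)+\|\mathcal A X-b\|^2 .$$ Let $D=\{X\in\mathbb R^{m\times n}:\operatorname{rank}X\le p\}$, the set of all products $BC^T$ (so $D=\mathbb R^{m\times n}$ if $\min(m,n)\le p$). Then the problems $\min_{B,C}F(B,C)$ over $\mathbb R^{m\times p}\times\mathbb R^{n\times p}$ and $\min_{X\in D}G(X)$ are equivalent in the following sense: their infima are finite and equal; one is attained if and only if the other is; $(B,C)$ is a global minimizer of $F$ if and only if $BC^T$ is a global minimizer of $G$ on $D$ and $F(B,C)=G(BC^T)$; and every global minimizer $X$ of $G$ on $D$ is of the form $X=BC^T$ with $(B,C)$ a global minimizer of $F$. In particular, if $\min(m,n)\le p$, then minimizing $F$ is equivalent, in this sense, to minimizing $G$ over all of $\mathbb R^{m\times n}$. -/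

import Mathlib

open scoped Matrix

noncomputable section

/-- The vector `γ(B, C)`: `γᵢ = (‖Bᵢ‖² + ‖Cᵢ‖²) / 2`, where `Bᵢ`, `Cᵢ` are the `i`-th columns of
`B` and `C` and the norm is the Euclidean one. -/
def gammaVec {m n p : ℕ} (B : Matrix (Fin m) (Fin p) ℝ) (C : Matrix (Fin n) (Fin p) ℝ) :
    Fin p → ℝ :=
  fun i => (‖WithLp.toLp 2 (fun k => B k i)‖ ^ 2 + ‖WithLp.toLp 2 (fun k => C k i)‖ ^ 2) / 2

/-- The vector of the `p` largest singular values of `X` in non-increasing order, with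
multiplicity, filled up with zeros when `p` exceeds the size of `X`. -/
def sigmaVec {m n : ℕ} (p : ℕ) (X : Matrix (Fin m) (Fin n) ℝ) : Fin p → ℝ :=
  fun i => (Matrix.toEuclideanLin X).singularValues i

/-- The objective `aᵀ γ(B, C) + ‖𝒜(B Cᵀ) - b‖²` of the bilinear problem. -/
def bilinearObjective {m n p : ℕ} {W : Type*} [NormedAddCommGroup W] [InnerProductSpace ℝ W]
    (a : Fin p → ℝ) (A : Matrix (Fin m) (Fin n) ℝ →ₗ[ℝ] W) (b : W)
    (z : Matrix (Fin m) (Fin p) ℝ × Matrix (Fin n) (Fin p) ℝ) : ℝ :=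
  a ⬝ᵥ gammaVec z.1 z.2 + ‖A (z.1 * z.2ᵀ) - b‖ ^ 2

/-- The objective `aᵀ σ(X) + ‖𝒜 X - b‖²` of the weighted nuclear norm problem. -/
def nuclearObjective {m n p : ℕ} {W : Type*} [NormedAddCommGroup W] [InnerProductSpace ℝ W]
    (a : Fin p → ℝ) (A : Matrix (Fin m) (Fin n) ℝ →ₗ[ℝ] W) (b : W)
    (X : Matrix (Fin m) (Fin n) ℝ) : ℝ :=
  a ⬝ᵥ sigmaVec p X + ‖A X - b‖ ^ 2

/-- Minimizing `F` over all of `α` is equivalent, through the substitution `π : α → β`, to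
minimizing `G` over `D ⊆ β`: the substitution maps onto `D`, the two infima are finite and equal,
one problem attains its minimum iff the other does (with the same minimum value), the point `z`
minimizes `F` exactly when `π z` minimizes `G` and `z` realizes the value `G (π z)`, and every
minimizer of `G` comes from a minimizer of `F`. -/
def EquivalentProblems {α β : Type*} (π : α → β) (F : α → ℝ) (D : Set β) (G : β → ℝ) : Prop :=
  Set.range π = D ∧
  (∃ v : ℝ, IsGLB (Set.range F) v ∧ IsGLB (G '' D) v) ∧
  (∀ v : ℝ, IsLeast (Set.range F) v ↔ IsLeast (G '' D) v) ∧
  (∀ z : α, IsMinOn F Set.univ z ↔ IsMinOn G D (π z) ∧ F z = G (π z)) ∧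
  (∀ x ∈ D, IsMinOn G D x → ∃ z : α, π z = x ∧ IsMinOn F Set.univ z)

end

/-! The fidelity term depends only on $BC^T$, so part 2 follows formally from part 1 and the bound
$G\ge 0$. For part 1, the weights are nonnegative and nondecreasing, so summation by parts
(`sum_mul_nonneg_of_tail_nonneg`) reduces $a^T\sigma\le a^T\gamma$ to tail sums; by AM-GM it
suffices that $\sum_{i\ge k}\sigma_i\le\sum_{i\ge k}\|B_i\|\|C_i\|$ (`sum_tail_singularValues_le`).
Let $P$ project onto the orthogonal complement of the span of the first $k$ columns of $C$, let
$Tv_j=\sigma_ju_j$ be an SVD of $T=BC^T$, and let $W$ be the contraction $v_j\mapsto u_j$. One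
trace, computed in two ways, gives $\sum_j\sigma_j\|Pv_j\|^2=\sum_i\langle WPC_i,B_i\rangle$. On the
right the first $k$ terms vanish and Cauchy-Schwarz bounds the others. On the left the weights lie
in $[0,1]$ and fall short of 1 by at most $k$ in total, so the loss is at most the $k$ largest
$\sigma_j$ (`sum_tail_le_sum_mul`). Equality holds for $B_i=\sqrt{\sigma_i}\,u_i$,
$C_i=\sqrt{\sigma_i}\,v_i$. -/

open scoped InnerProductSpace in
/-- Every linear map from an `n`-dimensional space has a singular value decomposition. -/
theorem LinearMap.exists_singularValueDecomposition {E F : Type*} [NormedAddCommGroup E]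
    [InnerProductSpace ℝ E] [FiniteDimensional ℝ E] [NormedAddCommGroup F]
    [InnerProductSpace ℝ F] [FiniteDimensional ℝ F] {n : ℕ} (hn : Module.finrank ℝ E = n)
    (T : E →ₗ[ℝ] F) :
    ∃ (v : OrthonormalBasis (Fin n) ℝ E) (u : Fin n → F),
      (∀ j, T (v j) = T.singularValues j • u j) ∧ (∀ i j, i ≠ j → ⟪u i, u j⟫_ℝ = 0) ∧
      (∀ j : Fin n, T.singularValues j ≠ 0 → ‖u j‖ = 1) ∧ (∀ j, ‖u j‖ ≤ 1) := by
  set v := T.isSymmetric_adjoint_comp_self.eigenvectorBasis hn with hv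
  have hinner (i j : Fin n) :
      ⟪T (v i), T (v j)⟫_ℝ = T.singularValues j ^ 2 * ⟪v i, v j⟫_ℝ := by
    rw [← LinearMap.adjoint_inner_right, ← LinearMap.comp_apply, hv,
      T.isSymmetric_adjoint_comp_self.apply_eigenvectorBasis hn j, T.sq_singularValues_fin hn,
      inner_smul_right]
    rfl
  have hnorm (j : Fin n) : ‖T (v j)‖ = T.singularValues j := by
    have h := hinner j j
    rw [real_inner_self_eq_norm_sq, real_inner_self_eq_norm_sq, v.norm_eq_one] at h
    exact (sq_eq_sq₀ (norm_nonneg _) (T.singularValues_nonneg j)).mp (by simpa using h)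
  have hone (j : Fin n) (hj : T.singularValues j ≠ 0) :
      ‖(T.singularValues j)⁻¹ • T (v j)‖ = 1 := by
    rw [norm_smul, hnorm, norm_inv, Real.norm_of_nonneg (T.singularValues_nonneg j),
      inv_mul_cancel₀ hj]
  -- Since `0⁻¹ = 0`, this vector is zero when the singular value is. No completion to an
  -- orthonormal family is needed, and none need exist if `F` has smaller dimension than `E`.
  refine ⟨v, fun j => (T.singularValues j)⁻¹ • T (v j), fun j => ?_, fun i j hij => ?_, hone,
    fun j => ?_⟩
  · by_cases hj : T.singularValues j = 0
    · rw [hj, zero_smul, ← norm_eq_zero, hnorm, hj]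
    · rw [smul_inv_smul₀ hj]
  · rw [inner_smul_left, inner_smul_right, hinner, v.inner_eq_zero hij]
    simp
  · by_cases hj : T.singularValues j = 0
    · simp [hj]
    · exact (hone j hj).le

open scoped InnerProductSpace in
/-- Linear combinations of pairwise orthogonal vectors in the unit ball with the coordinates of `x`
are no longer than `x`. -/
theorem norm_sum_inner_smul_le {E F ι : Type*} [Fintype ι] [NormedAddCommGroup E]
    [InnerProductSpace ℝ E] [NormedAddCommGroup F] [InnerProductSpace ℝ F]
    (v : OrthonormalBasis ι ℝ E) {u : ι → F} (hu : ∀ i j, i ≠ j → ⟪u i, u j⟫_ℝ = 0)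
    (hu1 : ∀ j, ‖u j‖ ≤ 1) (x : E) : ‖∑ j, ⟪v j, x⟫_ℝ • u j‖ ≤ ‖x‖ := by
  classical
  refine le_of_sq_le_sq ?_ (norm_nonneg x)
  rw [← real_inner_self_eq_norm_sq, ← v.sum_sq_norm_inner_right x, sum_inner]
  refine Finset.sum_le_sum fun i _ => ?_
  rw [inner_sum, Finset.sum_eq_single i]
  · rw [inner_smul_left, inner_smul_right, real_inner_self_eq_norm_sq, Real.norm_eq_abs, sq_abs]
    have : ‖u i‖ ^ 2 ≤ 1 := pow_le_one₀ (norm_nonneg _) (hu1 i)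
    simp only [conj_trivial]
    nlinarith [sq_nonneg ⟪v i, x⟫_ℝ]
  · intro j _ hj
    rw [inner_smul_left, inner_smul_right, hu i j hj.symm, mul_zero, mul_zero]
  · simp

/-- The squared lengths of the projections of an orthonormal basis add up to the dimension. -/
theorem OrthonormalBasis.sum_norm_sq_starProjection {E ι : Type*} [Fintype ι]
    [NormedAddCommGroup E] [InnerProductSpace ℝ E] [FiniteDimensional ℝ E]
    (v : OrthonormalBasis ι ℝ E) (K : Submodule ℝ E) :
    ∑ j, ‖K.starProjection (v j)‖ ^ 2 = Module.finrank ℝ K := by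
  have h (j : ι) : ‖K.starProjection (v j)‖ ^ 2 =
      ∑ l, ‖inner ℝ ((stdOrthonormalBasis ℝ K l : K) : E) (v j)‖ ^ 2 := by
    rw [K.starProjection_apply, ← Submodule.coe_norm,
      ← (stdOrthonormalBasis ℝ K).sum_sq_norm_inner_right]
    simp_rw [Submodule.inner_orthogonalProjectionOnto_eq_of_mem_left]
  simp_rw [h]
  rw [Finset.sum_comm]
  simp_rw [v.sum_sq_norm_inner_left]
  simp [← Submodule.coe_norm]

/-! ### Inequalities for weighted sums and tail sums -/

/-- A weighted sum of an antitone sequence with weights in `[0, 1]` whose complements add up to at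
most `k` dominates every tail sum of the sequence starting at `k`. -/
theorem sum_tail_le_sum_mul {n p k : ℕ} {s : ℕ → ℝ} (hs : Antitone s) (hs0 : ∀ i, 0 ≤ s i)
    (hsn : ∀ i, n ≤ i → s i = 0) {c : Fin n → ℝ} (hc0 : ∀ j, 0 ≤ c j) (hc1 : ∀ j, c j ≤ 1)
    (hck : ∑ j, (1 - c j) ≤ k) :
    ∑ i : Fin p, (if k ≤ (i : ℕ) then s i else 0) ≤ ∑ j : Fin n, s j * c j := by
  have h1 : ∑ i : Fin p, (if k ≤ (i : ℕ) then s i else 0) ≤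
      ∑ j : Fin n, (if k ≤ (j : ℕ) then s j else 0) := by
    rw [Fin.sum_univ_eq_sum_range (fun i => if k ≤ i then s i else 0) p,
      Fin.sum_univ_eq_sum_range (fun i => if k ≤ i then s i else 0) n]
    have hnn (i : ℕ) : 0 ≤ if k ≤ i then s i else 0 := by split_ifs <;> simp [hs0]
    calc _ ≤ ∑ i ∈ Finset.range (max n p), (if k ≤ i then s i else 0) :=
          Finset.sum_le_sum_of_subset_of_nonneg (by simp) fun i _ _ => hnn i
      _ = _ := (Finset.sum_subset (by simp) fun i _ hi => by
          simp [hsn i (by simpa using hi)]).symm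
  refine h1.trans ?_
  -- The threshold `s k` separates the two cases: `s j ≤ s k` for `j ≥ k`, and `s j ≥ s k` for `j <
  -- k`.
  have h2 (j : Fin n) : (if k ≤ (j : ℕ) then s j else 0) - s j * c j ≤
      s k * ((1 - c j) - if (j : ℕ) < k then 1 else 0) := by
    rcases le_or_gt k j with h | h
    · rw [if_pos h, if_neg h.not_gt]
      nlinarith [hs h, hc1 j]
    · rw [if_neg h.not_ge, if_pos h]
      nlinarith [hs h.le, hc0 j]
  have h3 := Finset.sum_le_sum fun j (_ : j ∈ Finset.univ) => h2 j
  rw [Finset.sum_sub_distrib, ← Finset.mul_sum, Finset.sum_sub_distrib,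
    Fin.sum_univ_eq_sum_range (fun i => if i < k then (1 : ℝ) else 0) n] at h3
  -- If `n ≤ k`, fewer than `k` indices may be counted, but then `s k = 0` and the bound is trivial.
  rcases le_or_gt n k with h | h
  · rw [hsn k h] at h3
    linarith
  · have h4 : ∑ i ∈ Finset.range n, (if i < k then (1 : ℝ) else 0) = k := by
      rw [← Finset.sum_filter, Finset.sum_const, nsmul_one,
        show (Finset.range n).filter (· < k) = Finset.range k by ext; simp; omega,
        Finset.card_range]
    rw [h4] at h3
    nlinarith [hs0 k]

/-- Summation by parts: monotone nonnegative weights preserve nonnegativity of tail sums. -/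
theorem sum_mul_nonneg_of_tail_nonneg : ∀ {p : ℕ} {a d : Fin p → ℝ}, (∀ i, 0 ≤ a i) →
    Monotone a → (∀ k : ℕ, 0 ≤ ∑ i : Fin p, if k ≤ (i : ℕ) then d i else 0) →
    0 ≤ ∑ i, a i * d i
  | 0, _, _, _, _, _ => by simp
  | p + 1, a, d, ha, hmono, hd => by
    -- Subtracting the smallest weight `a 0` from all weights kills the first term and keeps the
    -- others nonnegative and monotone.
    have ih := sum_mul_nonneg_of_tail_nonneg (a := fun i : Fin p => a i.succ - a 0)
      (d := fun i => d i.succ) (fun i => sub_nonneg.2 (hmono (Fin.zero_le _)))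
      (fun i j h => sub_le_sub_right (hmono (Fin.succ_le_succ_iff.2 h)) _) fun k => by
        simpa [Fin.sum_univ_succ] using hd (k + 1)
    have h0 : 0 ≤ ∑ i, d i := by simpa using hd 0
    have h : ∑ i, a i * d i =
        a 0 * ∑ i, d i + ∑ i : Fin p, (a i.succ - a 0) * d i.succ := by
      simp only [sub_mul, Finset.sum_sub_distrib, Fin.sum_univ_succ, mul_add, Finset.mul_sum]
      ring
    rw [h]
    exact add_nonneg (mul_nonneg (ha 0) h0) ih

/-! ### Tail sums of singular values -/

open scoped InnerProductSpace in
/-- If `T = ∑ i, Bᵢ ⟪Cᵢ, ·⟫`, the tail sums of the singular values of `T` are bounded by those of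
`‖Bᵢ‖ * ‖Cᵢ‖`. -/
theorem sum_tail_singularValues_le {E F : Type*} [NormedAddCommGroup E]
    [InnerProductSpace ℝ E] [FiniteDimensional ℝ E] [NormedAddCommGroup F]
    [InnerProductSpace ℝ F] [FiniteDimensional ℝ F] {p : ℕ} (T : E →ₗ[ℝ] F) (B : Fin p → F)
    (C : Fin p → E) (hT : ∀ x, T x = ∑ i, ⟪C i, x⟫_ℝ • B i) (k : ℕ) :
    ∑ i : Fin p, (if k ≤ (i : ℕ) then T.singularValues i else 0) ≤
      ∑ i : Fin p, if k ≤ (i : ℕ) then ‖B i‖ * ‖C i‖ else 0 := by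
  classical
  obtain ⟨v, u, hv, hu, hu1, hu1'⟩ := T.exists_singularValueDecomposition rfl
  let K : Submodule ℝ E := Submodule.span ℝ
    (((Finset.univ.filter fun i : Fin p => (i : ℕ) < k).image C : Finset E) : Set E)
  have hK : Module.finrank ℝ K ≤ k := by
    refine (finrank_span_finset_le_card _).trans (Finset.card_image_le.trans ?_)
    calc _ = ((Finset.univ.filter fun i : Fin p => (i : ℕ) < k).map Fin.valEmbedding).card := by
          rw [Finset.card_map]
      _ ≤ (Finset.range k).card := Finset.card_le_card fun x hx => by
          simp only [Finset.mem_map, Finset.mem_filter] at hx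
          obtain ⟨i, hi, rfl⟩ := hx
          simpa using hi.2
      _ = k := Finset.card_range k
  have hsplit (x : E) : ‖x‖ ^ 2 = ‖K.starProjection x‖ ^ 2 + ‖Kᗮ.starProjection x‖ ^ 2 :=
    Submodule.norm_sq_eq_add_norm_sq_starProjection x K
  have hone (j) : ‖K.starProjection (v j)‖ ^ 2 + ‖Kᗮ.starProjection (v j)‖ ^ 2 = 1 := by
    rw [← hsplit, v.norm_eq_one, one_pow]
  have h1 := sum_tail_le_sum_mul (p := p) (k := k) T.singularValues_antitone
    T.singularValues_nonneg (fun i hi => T.singularValues_of_finrank_le hi)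
    (c := fun j => ‖Kᗮ.starProjection (v j)‖ ^ 2) (fun j => sq_nonneg _)
    (fun j => by nlinarith [hone j, sq_nonneg ‖K.starProjection (v j)‖]) (by
      calc _ = ∑ j, ‖K.starProjection (v j)‖ ^ 2 :=
            Finset.sum_congr rfl fun j _ => by linarith [hone j]
        _ ≤ k := by rw [v.sum_norm_sq_starProjection]; exact_mod_cast hK)
  refine h1.trans ?_
  let W : E →ₗ[ℝ] F := ∑ j, ((innerₗ E (v j)).smulRight (u j))
  have hW (x : E) : W x = ∑ j, ⟪v j, x⟫_ℝ • u j := by simp [W]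
  -- Orthogonality of the `u i` leaves only `⟪v j, P (v j)⟫`, which is `‖P (v j)‖ ^ 2` because `P`
  -- is a self-adjoint idempotent.
  have hdiag (j : Fin (Module.finrank ℝ E)) : T.singularValues j * ‖Kᗮ.starProjection (v j)‖ ^ 2 =
      ⟪W (Kᗮ.starProjection (v j)), T (v j)⟫_ℝ := by
    rw [hW, hv, inner_smul_right, sum_inner, Finset.sum_eq_single j]
    · by_cases hj : T.singularValues j = 0
      · simp [hj]
      · rw [inner_smul_left, real_inner_self_eq_norm_sq, hu1 j hj,
          ← real_inner_self_eq_norm_sq, Submodule.inner_starProjection_left_eq_right,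
          Submodule.starProjection_eq_self_iff.2 (Submodule.starProjection_apply_mem _ _)]
        simp
    · intro i _ hij
      rw [inner_smul_left, hu i j hij, mul_zero]
    · simp
  -- Expand `T (v j)` through the `B i`, swap the sums, and reassemble `C i` from its coordinates in
  -- the basis `v`.
  have hexp : ∑ j : Fin (Module.finrank ℝ E), T.singularValues j * ‖Kᗮ.starProjection (v j)‖ ^ 2 =
      ∑ i, ⟪W (Kᗮ.starProjection (C i)), B i⟫_ℝ := by
    simp_rw [hdiag, hT, inner_sum, inner_smul_right]
    rw [Finset.sum_comm]
    refine Finset.sum_congr rfl fun i _ => ?_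
    conv_rhs => rw [← v.sum_repr' (C i)]
    simp only [map_sum, map_smul, sum_inner, inner_smul_left, conj_trivial]
    exact Finset.sum_congr rfl fun j _ => by rw [real_inner_comm (C i)]
  rw [hexp]
  refine Finset.sum_le_sum fun i _ => ?_
  split_ifs with hi
  · refine (real_inner_le_norm _ _).trans ?_
    rw [mul_comm]
    gcongr
    rw [hW]
    exact (norm_sum_inner_smul_le v hu hu1' _).trans (Submodule.norm_starProjection_apply_le _ _)
  · have hmem : C i ∈ K := Submodule.subset_span (by
      simpa using ⟨i, not_le.1 hi, rfl⟩)
    have h0 : Kᗮ.starProjection (C i) = 0 :=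
      Submodule.starProjection_orthogonal_apply_eq_zero hmem
    simp [h0]

/-! ### Matrix factorizations -/

theorem toEuclideanLin_mul_transpose_apply {m n p : ℕ} (B : Matrix (Fin m) (Fin p) ℝ)
    (C : Matrix (Fin n) (Fin p) ℝ) (x : EuclideanSpace ℝ (Fin n)) :
    Matrix.toEuclideanLin (B * Cᵀ) x =
      ∑ i, inner ℝ (WithLp.toLp 2 fun k => C k i) x • WithLp.toLp 2 fun k => B k i := by
  ext l
  simp only [Matrix.toLpLin_apply, ← Matrix.mulVec_mulVec]
  simp [Matrix.mulVec, dotProduct, PiLp.inner_apply, mul_comm]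

/-- A weighted factorization cost is at least the weighted sum of singular values. -/
theorem dotProduct_sigmaVec_le_dotProduct_gammaVec {m n p : ℕ} {a : Fin p → ℝ}
    (ha : ∀ i, 0 ≤ a i) (hmono : Monotone a) (B : Matrix (Fin m) (Fin p) ℝ)
    (C : Matrix (Fin n) (Fin p) ℝ) : a ⬝ᵥ sigmaVec p (B * Cᵀ) ≤ a ⬝ᵥ gammaVec B C := by
  have h := sum_mul_nonneg_of_tail_nonneg
    (d := fun i => gammaVec B C i - sigmaVec p (B * Cᵀ) i) ha hmono fun k => by
      have h1 := sum_tail_singularValues_le _ _ _ (toEuclideanLin_mul_transpose_apply B C) k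
      have h2 : ∑ i : Fin p, (if k ≤ (i : ℕ) then ‖WithLp.toLp 2 (fun k => B k i)‖ *
          ‖WithLp.toLp 2 (fun k => C k i)‖ else 0) ≤
          ∑ i : Fin p, if k ≤ (i : ℕ) then gammaVec B C i else 0 := by
        refine Finset.sum_le_sum fun i _ => ?_
        split_ifs
        · rw [gammaVec]
          linarith [two_mul_le_add_sq ‖WithLp.toLp 2 (fun k => B k i)‖
            ‖WithLp.toLp 2 (fun k => C k i)‖]
        · rfl
      have h3 := sub_nonneg.2 (h1.trans h2)
      rw [← Finset.sum_sub_distrib] at h3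
      refine h3.trans_eq (Finset.sum_congr rfl fun i _ => ?_)
      split_ifs
      · rfl
      · simp
  simp only [mul_sub, Finset.sum_sub_distrib] at h
  exact sub_nonneg.1 h

/-- The balanced factorization obtained from a singular value decomposition. -/
theorem exists_mul_transpose_eq_gammaVec_eq_sigmaVec {m n p : ℕ} (X : Matrix (Fin m) (Fin n) ℝ)
    (hX : X.rank ≤ p) : ∃ (B : Matrix (Fin m) (Fin p) ℝ) (C : Matrix (Fin n) (Fin p) ℝ),
      B * Cᵀ = X ∧ gammaVec B C = sigmaVec p X := by
  set T := Matrix.toEuclideanLin X with hT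
  obtain ⟨v, u, hv, hu, hu1, hu1'⟩ :=
    T.exists_singularValueDecomposition (n := n) (by simp)
  have hs0 (i : ℕ) (hi : p ≤ i) : T.singularValues i = 0 := by
    rw [T.singularValues_eq_zero_iff_le_finrank_range]
    exact (X.rank_eq_finrank_range_toLin (EuclideanSpace.basisFun _ ℝ).toBasis
      (EuclideanSpace.basisFun _ ℝ).toBasis).symm.le.trans (hX.trans hi)
  -- Padding by zero covers `p > n`; if `p < n`, the omitted terms vanish by `hs0`, which is where
  -- the rank bound enters.
  let b (i : ℕ) : EuclideanSpace ℝ (Fin m) :=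
    if h : i < n then √(T.singularValues i) • u ⟨i, h⟩ else 0
  let c (i : ℕ) : EuclideanSpace ℝ (Fin n) :=
    if h : i < n then √(T.singularValues i) • v ⟨i, h⟩ else 0
  refine ⟨Matrix.of fun k i => b i k, Matrix.of fun k i => c i k, ?_, ?_⟩
  · apply Matrix.toEuclideanLin.injective
    refine v.toBasis.ext fun j => ?_
    rw [v.coe_toBasis, ← hT, hv, toEuclideanLin_mul_transpose_apply]
    change ∑ i : Fin p, inner ℝ (c i) (v j) • b i = _
    have hterm (i : ℕ) : inner ℝ (c i) (v j) • b i =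
        if i = (j : ℕ) then T.singularValues j • u j else 0 := by
      by_cases hi : i < n
      · simp only [b, c, dif_pos hi, inner_smul_left, orthonormal_iff_ite.1 v.orthonormal]
        by_cases hij : i = (j : ℕ)
        · subst hij
          simp [smul_smul, Real.mul_self_sqrt (T.singularValues_nonneg _)]
        · simp [hij, Fin.ext_iff]
      · have : i ≠ j := by omega
        simp [b, hi, this]
    simp_rw [hterm]
    rw [Fin.sum_univ_eq_sum_range (fun i => if i = (j : ℕ) then T.singularValues j • u j else 0),
      Finset.sum_ite_eq']
    split_ifs with h
    · rfl
    · rw [hs0 j (by simpa using h), zero_smul]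
  · ext i
    change (‖b i‖ ^ 2 + ‖c i‖ ^ 2) / 2 = T.singularValues i
    by_cases hi : (i : ℕ) < n
    · simp only [b, c, dif_pos hi, norm_smul, mul_pow, v.norm_eq_one, Real.norm_eq_abs, sq_abs,
        Real.sq_sqrt (T.singularValues_nonneg _)]
      by_cases h : T.singularValues i = 0
      · simp [h]
      · rw [hu1 ⟨i, hi⟩ h]
        ring
    · simp [b, c, hi, T.singularValues_of_finrank_le (i := i) (by simpa using hi)]

/-! ### Equivalence of the two problems -/

/-- Two problems are equivalent if `π` maps into `D`, `G ∘ π ≤ F`, and every value of `G` on `D` is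
attained by `F` on the fibre of `π`. -/
theorem EquivalentProblems.of_le_of_exists {α β : Type*} {π : α → β} {F : α → ℝ} {D : Set β}
    {G : β → ℝ} (hπ : ∀ z, π z ∈ D) (hle : ∀ z, G (π z) ≤ F z)
    (hex : ∀ x ∈ D, ∃ z, π z = x ∧ F z = G x) (hD : D.Nonempty) (hG : ∀ x ∈ D, 0 ≤ G x) :
    EquivalentProblems π F D G := by
  -- Equal sets of lower bounds give equal infima and reduce attainment to transporting a single
  -- point.
  have hlb : lowerBounds (Set.range F) = lowerBounds (G '' D) := by
    ext v
    constructor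
    · rintro h _ ⟨x, hx, rfl⟩
      obtain ⟨z, -, hz⟩ := hex x hx
      exact hz ▸ h ⟨z, rfl⟩
    · rintro h _ ⟨z, rfl⟩
      exact (h ⟨π z, hπ z, rfl⟩).trans (hle z)
  refine ⟨?_, ?_, fun v => ⟨?_, ?_⟩, fun z => ⟨fun h => ?_, fun h y _ => ?_⟩, fun x hx h => ?_⟩
  · ext x
    exact ⟨by rintro ⟨z, rfl⟩; exact hπ z, fun hx => (hex x hx).imp fun z hz => hz.1⟩
  · have h := isGLB_csInf (hD.image G) ⟨0, by rintro _ ⟨x, hx, rfl⟩; exact hG x hx⟩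
    exact ⟨_, by rwa [IsGLB, hlb], h⟩
  · rintro ⟨⟨z, rfl⟩, h⟩
    rw [hlb] at h
    refine ⟨⟨π z, hπ z, (hle z).antisymm (h ⟨π z, hπ z, rfl⟩)⟩, h⟩
  · rintro ⟨⟨x, hx, rfl⟩, h⟩
    obtain ⟨z, -, hz⟩ := hex x hx
    exact ⟨⟨z, hz⟩, hlb ▸ h⟩
  · have h' : ∀ x ∈ D, F z ≤ G x := fun x hx => by
      obtain ⟨y, -, hy⟩ := hex x hx
      exact hy ▸ h (Set.mem_univ y)
    exact ⟨fun x hx => (hle z).trans (h' x hx), (h' _ (hπ z)).antisymm (hle z)⟩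
  · exact h.2.le.trans ((h.1 (hπ y)).trans (hle y))
  · obtain ⟨z, hz, hzG⟩ := hex x hx
    exact ⟨z, hz, fun y _ => hzG.le.trans ((h (hπ y)).trans (hle y))⟩

theorem rank_mul_transpose_le {m n p : ℕ} (B : Matrix (Fin m) (Fin p) ℝ)
    (C : Matrix (Fin n) (Fin p) ℝ) : (B * Cᵀ).rank ≤ p :=
  (Matrix.rank_mul_le_left _ _).trans ((Matrix.rank_le_card_width B).trans (by simp))

theorem mainTheorem3 (m n p : ℕ) (a : Fin p → ℝ) (ha : ∀ i, 0 ≤ a i) (hmono : Monotone a) :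
    -- for fixed `X`: the minimum over factorizations is `aᵀ σ(X)`, attained with `γ = σ`
    (∀ X : Matrix (Fin m) (Fin n) ℝ, X.rank ≤ p →
      IsLeast {t : ℝ | ∃ (B : Matrix (Fin m) (Fin p) ℝ) (C : Matrix (Fin n) (Fin p) ℝ),
          B * Cᵀ = X ∧ a ⬝ᵥ gammaVec B C = t} (a ⬝ᵥ sigmaVec p X) ∧
      ∃ (B : Matrix (Fin m) (Fin p) ℝ) (C : Matrix (Fin n) (Fin p) ℝ),
          B * Cᵀ = X ∧ gammaVec B C = sigmaVec p X) ∧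
    -- equivalence of the two regularized problems
    (∀ {W : Type*} [NormedAddCommGroup W] [InnerProductSpace ℝ W]
      (A : Matrix (Fin m) (Fin n) ℝ →ₗ[ℝ] W) (b : W),
      EquivalentProblems
        (fun z : Matrix (Fin m) (Fin p) ℝ × Matrix (Fin n) (Fin p) ℝ => z.1 * z.2ᵀ)
        (bilinearObjective a A b) {X | X.rank ≤ p} (nuclearObjective a A b) ∧
      (min m n ≤ p →
        EquivalentProblems
          (fun z : Matrix (Fin m) (Fin p) ℝ × Matrix (Fin n) (Fin p) ℝ => z.1 * z.2ᵀ)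
          (bilinearObjective a A b) Set.univ (nuclearObjective a A b))) := by

  refine ⟨fun X hX => ?_, fun {W} _ _ A b => ?_⟩
  · obtain ⟨B, C, hBC, hγ⟩ := exists_mul_transpose_eq_gammaVec_eq_sigmaVec X hX
    refine ⟨⟨⟨B, C, hBC, by rw [hγ]⟩, ?_⟩, B, C, hBC, hγ⟩
    rintro _ ⟨B, C, rfl, rfl⟩
    exact dotProduct_sigmaVec_le_dotProduct_gammaVec ha hmono B C
  · have key : EquivalentProblems
        (fun z : Matrix (Fin m) (Fin p) ℝ × Matrix (Fin n) (Fin p) ℝ => z.1 * z.2ᵀ)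
        (bilinearObjective a A b) {X | X.rank ≤ p} (nuclearObjective a A b) := by
      refine .of_le_of_exists (fun z => rank_mul_transpose_le z.1 z.2) (fun z => ?_)
        (fun X hX => ?_) ⟨0, by simp⟩ fun X _ => ?_
      · exact add_le_add_left (dotProduct_sigmaVec_le_dotProduct_gammaVec ha hmono z.1 z.2) _
      · obtain ⟨B, C, hBC, hγ⟩ := exists_mul_transpose_eq_gammaVec_eq_sigmaVec X hX
        exact ⟨(B, C), hBC, by simp only [bilinearObjective, nuclearObjective, hBC, hγ]⟩
      · exact add_nonneg (Finset.sum_nonneg fun i _ =>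
          mul_nonneg (ha i) (LinearMap.singularValues_nonneg _ _)) (sq_nonneg _)
    refine ⟨key, fun h => ?_⟩
    have hD : {X : Matrix (Fin m) (Fin n) ℝ | X.rank ≤ p} = Set.univ :=
      Set.eq_univ_of_forall fun X => (le_min (X.rank_le_height) (X.rank_le_width)).trans h
    rwa [hD] at key
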